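/- Consider the additive white Gaussian noise channel $Y_i = X_i + Z_i$ with noisy feedback $\tilde Y_i = Y_i + \tilde Z_i$, where $Z_i\sim \mathrm N(0,1)$ and $\tilde Z_i\sim \mathrm N(0,\alpha)$, $\alpha\ge 0$, are all mutually independent. For $M\ge 2$ and $P \ge 0$, an $(M,n)$ code consists of (measurable) encoding functions $x_i(w,\tilde y^{i-1})$, $1\le i\le n$, $w\in\{1,\dots,M\}$, where $\tilde y^{i-1}=(\tilde y_1,\dots,\tilde y_{i-1})$, and a (measurable) decoding function $\hat w(y^n)\in\{1,\dots,M\}$, where $y^n=(y_1,\dots,y_n)$. When message $w$ is sent, $X_i = x_i(w,\tilde Y^{i-1})$. The code satisfies the peak energy constraint if, for every message $w$, $\sum_{i=1}^n x_i(w,\tilde Y^{i-1})^2\le nP$ with probability one. Its error probability is $\frac1M\sum_{w=1}^M \mathsf P\{\hat w(Y^n)\ne w \mid W=w\}$. Let $P_e^*(M,n)$ be the infimum of the error probability over all $(M,n)$ codes satisfying the peak energy constraint, and let $$E_M(\alpha)=\limsup_{n\to\infty} -\frac1n \ln P_e^*(M,n).$$ Theorem 1. For every $M\ge 2$, every $P\ge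 0$ and every $0\le s\le 1$, $$E_M(\alpha^*(s)) \ge \frac{P}{2}\left(1 - \frac{3(M-2)}{M(s^2-2s+4)+3(M-2)}\right),\qquad \alpha^*(s)=\frac{3s^2}{4(s^2-2s+4)}.$$ -/

import Mathlib

open MeasureTheory ProbabilityTheory Filter
open scoped NNReal ENNReal

namespace NoisyFeedback

/-- A code for `M` messages and block length `n` over a channel with (noisy) causal feedback.
At time `i` the encoder sees the message `w` and the past feedback values (those with index
smaller than `i`); the decoder sees all `n` channel outputs. Both maps are measurable. -/
structure Code (M n : ℕ) where
  /-- the encoding functions `x_i(w, ỹ^{i-1})` -/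
  enc : Fin M → (i : Fin n) → (Fin i → ℝ) → ℝ
  /-- the decoding function `ŵ(y^n)` -/
  dec : (Fin n → ℝ) → Fin M
  measurable_enc : ∀ w i, Measurable (enc w i)
  measurable_dec : Measurable dec

/-- The joint law of the noises `(Z^n, Z̃^n)`: all coordinates are independent, the forward noise
is `N(0, 1)` and the backward noise is `N(0, α)`. -/
noncomputable def noise (α : ℝ≥0) (n : ℕ) : Measure ((Fin n → ℝ) × (Fin n → ℝ)) :=
  (Measure.pi fun _ : Fin n => gaussianReal 0 1).prod
    (Measure.pi fun _ : Fin n => gaussianReal 0 α)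

namespace Code

variable {M n : ℕ}

/-- The feedback value `Ỹ_i = Y_i + Z̃_i = x_i(w, Ỹ^{i-1}) + Z_i + Z̃_i` for message `w` and
noise realization `ω = (z, z̃)`. -/
def feedback (c : Code M n) (w : Fin M) (ω : (Fin n → ℝ) × (Fin n → ℝ)) (i : Fin n) : ℝ :=
  c.enc w i (fun j : Fin i => c.feedback w ω ⟨j, j.isLt.trans i.isLt⟩) + ω.1 i + ω.2 i
termination_by i.val
decreasing_by exact j.isLt

/-- The channel input `X_i = x_i(w, Ỹ^{i-1})`. -/
def input (c : Code M n) (w : Fin M) (ω : (Fin n → ℝ) × (Fin n → ℝ)) (i : Fin n) : ℝ :=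
  c.enc w i (fun j : Fin i => c.feedback w ω ⟨j, j.isLt.trans i.isLt⟩)

/-- The channel output `Y_i = X_i + Z_i`. -/
def output (c : Code M n) (w : Fin M) (ω : (Fin n → ℝ) × (Fin n → ℝ)) (i : Fin n) : ℝ :=
  c.input w ω i + ω.1 i

/-- The peak energy constraint: for every message, `∑ X_i² ≤ n P` with probability one. -/
def PeakEnergy (c : Code M n) (α : ℝ≥0) (P : ℝ) : Prop :=
  ∀ w : Fin M, ∀ᵐ ω ∂(noise α n), ∑ i : Fin n, c.input w ω i ^ 2 ≤ n * P

/-- The probability of error for a uniformly distributed message independent of the noises. -/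
noncomputable def errorProb (c : Code M n) (α : ℝ≥0) : ℝ≥0∞ :=
  (∑ w : Fin M, noise α n {ω | c.dec (c.output w ω) ≠ w}) / M

end Code

/-- The best error probability over all codes that satisfy the peak energy constraint. -/
noncomputable def bestErrorProb (M n : ℕ) (P : ℝ) (α : ℝ≥0) : ℝ≥0∞ :=
  ⨅ (c : Code M n) (_ : c.PeakEnergy α P), c.errorProb α

/-- The best error exponent `E_M(α) = limsup_n -(1/n) ln P_e^*(M, n)`, an extended real. -/
noncomputable def errorExponent (M : ℕ) (P : ℝ) (α : ℝ≥0) : EReal :=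
  limsup (fun n : ℕ => -ENNReal.log (bestErrorProb M n P α) / (n : EReal)) atTop

/-- The feedback noise power `α*(s) = 3 s² / (4 (s² - 2 s + 4))`. -/
noncomputable def alphaStar (s : ℝ) : ℝ≥0 :=
  ⟨3 * s ^ 2 / (4 * (s ^ 2 - 2 * s + 4)),
    div_nonneg (by positivity) (by nlinarith [sq_nonneg (s - 1)])⟩

end NoisyFeedback

open scoped Topology

namespace NoisyFeedback

/-! ### Gaussian tails -/

/-! Only `M + 1` channel uses carry energy, with amplitudes of order `√n`. After simplex signalling
the sender learns from feedback which two messages lead, and spends energy only on separating those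
two. The receiver trusts a leading pair only if its margin exceeds `τ`; feedback perturbations of at
most `τ` then show the sender the same pair (`Leads.perturb`).

An error therefore needs one of three events (`twoStageCode_error`): a feedback noise difference
above `τ`; two rivals of `w`, one overtaking it and the other coming within `τ`; or a failed binary
test over both stages. With `m ^ 2 = 6 * u`, `A ^ 2 = (1 - s) ^ 2 * u`, `τ = m * s / 2` and noise
`alphaStar s`, the Chernoff exponents of all three equal `u * (s ^ 2 - 2 * s + 4) / 2`. Choosing `u`
to exhaust the energy `n * P` gives the claimed exponent, up to a factor independent of `n`. -/

lemma hasSubgaussianMGF_id_gaussianReal (v : ℝ≥0) :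
    HasSubgaussianMGF id v (gaussianReal 0 v) where
  integrable_exp_mul t := integrable_exp_mul_gaussianReal t
  mgf_le t := by rw [mgf_id_gaussianReal]; simp

/-- Chernoff bound for a linear combination of independent centred Gaussian coordinates. -/
lemma pi_gaussianReal_tail {n k : ℕ} (v : ℝ≥0) (e : Fin k → Fin n) (he : Function.Injective e)
    (c : Fin k → ℝ) {x : ℝ} (hx : 0 ≤ x) :
    (Measure.pi fun _ : Fin n => gaussianReal 0 v) {z | x ≤ ∑ j, c j * z (e j)}
      ≤ ENNReal.ofReal (Real.exp (-x ^ 2 / (2 * ((∑ j, c j ^ 2) * v)))) := by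
  have hind : iIndepFun (fun (j : Fin k) (z : Fin n → ℝ) => c j * z (e j))
      (Measure.pi fun _ : Fin n => gaussianReal 0 v) := by
    have h : iIndepFun (fun (i : Fin n) (z : Fin n → ℝ) => id (z i))
        (Measure.pi fun _ : Fin n => gaussianReal 0 v) :=
      iIndepFun_pi (X := fun _ => id) fun i => aemeasurable_id
    exact (h.precomp he).comp (fun j y => c j * y) fun j => measurable_const_mul (c j)
  have hsub : ∀ j ∈ Finset.univ, HasSubgaussianMGF (fun z : Fin n → ℝ => c j * z (e j))
      (.mk (c j ^ 2) (sq_nonneg _) * v) (Measure.pi fun _ : Fin n => gaussianReal 0 v) := by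
    intro j _
    have h : HasSubgaussianMGF id v
        ((Measure.pi fun _ : Fin n => gaussianReal 0 v).map (Function.eval (e j))) := by
      rw [(measurePreserving_eval (fun _ : Fin n => gaussianReal 0 v) (e j)).map_eq]
      exact hasSubgaussianMGF_id_gaussianReal v
    exact (HasSubgaussianMGF.of_map (μ := Measure.pi fun _ : Fin n => gaussianReal 0 v)
      (Y := Function.eval (e j)) (measurable_pi_apply (e j)).aemeasurable h).const_mul (c j)
  have hm := (HasSubgaussianMGF.sum_of_iIndepFun hind hsub).measure_ge_le hx
  rw [← ofReal_measureReal]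
  refine ENNReal.ofReal_le_ofReal (hm.trans_eq ?_)
  simp [Finset.sum_mul]

lemma noise_forward_tail {n k : ℕ} (α : ℝ≥0) (e : Fin k → Fin n) (he : Function.Injective e)
    (c : Fin k → ℝ) {x : ℝ} (hx : 0 ≤ x) :
    noise α n {ω | x ≤ ∑ j, c j * ω.1 (e j)}
      ≤ ENNReal.ofReal (Real.exp (-x ^ 2 / (2 * ∑ j, c j ^ 2))) := by
  have h := pi_gaussianReal_tail 1 e he c hx
  rw [← (measurePreserving_fst (μ := Measure.pi fun _ : Fin n => gaussianReal 0 1)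
    (ν := Measure.pi fun _ : Fin n => gaussianReal 0 α)).measure_preimage
    (measurableSet_le measurable_const (by fun_prop)).nullMeasurableSet] at h
  simpa [noise] using h

lemma noise_backward_tail {n k : ℕ} (α : ℝ≥0) (e : Fin k → Fin n) (he : Function.Injective e)
    (c : Fin k → ℝ) {x : ℝ} (hx : 0 ≤ x) :
    noise α n {ω | x ≤ ∑ j, c j * ω.2 (e j)}
      ≤ ENNReal.ofReal (Real.exp (-x ^ 2 / (2 * ((∑ j, c j ^ 2) * α)))) := by
  have h := pi_gaussianReal_tail α e he c hx
  rwa [← (measurePreserving_snd (μ := Measure.pi fun _ : Fin n => gaussianReal 0 1)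
    (ν := Measure.pi fun _ : Fin n => gaussianReal 0 α)).measure_preimage
    (measurableSet_le measurable_const (by fun_prop)).nullMeasurableSet] at h

lemma noise_zero_backward_eq_zero (n : ℕ) :
    ∀ᵐ ω ∂(noise 0 n), ω.2 = 0 := by
  have h : ∀ᵐ z ∂(Measure.pi fun _ : Fin n => gaussianReal 0 0), z = 0 := by
    have h' : ∀ᵐ z ∂(Measure.pi fun _ : Fin n => gaussianReal 0 0), ∀ i, z i = 0 := by
      refine ae_all_iff.2 fun i => ?_
      refine Measure.tendsto_eval_ae_ae.eventually (p := fun t : ℝ => t = 0) ?_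
      simp [gaussianReal_zero_var, ae_dirac_eq]
    filter_upwards [h'] with z hz using funext hz
  exact Measure.quasiMeasurePreserving_snd.ae h

/-! ### The two-stage code -/

section Scheme

variable {M : ℕ}

/-- The coordinates `a` and `b` exceed all others by more than `τ`. -/
def Leads (τ : ℝ) (v : Fin M → ℝ) (a b : Fin M) : Prop :=
  ∀ c, c ≠ a → c ≠ b → v c + τ < v a ∧ v c + τ < v b

lemma Leads.symm {τ : ℝ} {v : Fin M → ℝ} {a b : Fin M} (h : Leads τ v a b) : Leads τ v b a :=
  fun c hb ha => (h c ha hb).symm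

/-- Two distinct partners of `w` would each strictly exceed the other. Hence the sign in `antipodal`
is unambiguous. -/
lemma Leads.unique {v : Fin M → ℝ} {w a b : Fin M} (ha : Leads 0 v w a) (hb : Leads 0 v w b)
    (haw : a ≠ w) (hbw : b ≠ w) : a = b := by
  by_contra hab
  have h1 := (ha b hbw (Ne.symm hab)).2
  have h2 := (hb a haw hab).2
  linarith

/-- Perturbing all coordinates by amounts differing by at most `τ` keeps the leading pair. -/
lemma Leads.perturb {τ : ℝ} {v v' : Fin M → ℝ} {a b : Fin M} (h : Leads τ v a b)
    (hv : ∀ i c, (v' c - v c) - (v' i - v i) ≤ τ) : Leads 0 v' a b := by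
  intro c hca hcb
  have h0 := h c hca hcb
  have h1 := hv a c
  have h2 := hv b c
  constructor <;> linarith

lemma measurable_leads (τ : ℝ) (a b : Fin M) : Measurable fun v : Fin M → ℝ => Leads τ v a b := by
  unfold Leads
  refine Measurable.forall fun c => Measurable.imp measurable_const <|
    Measurable.imp measurable_const <| Measurable.and ?_ ?_
  · exact measurableSet_setOfPred.1 (measurableSet_lt (by fun_prop) (by fun_prop))
  · exact measurableSet_setOfPred.1 (measurableSet_lt (by fun_prop) (by fun_prop))

/-- The sign that message `w` uses in the second stage against message `a`. -/
def pairSign (w a : Fin M) : ℝ := if w < a then 1 else -1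

lemma pairSign_sq (w a : Fin M) : pairSign w a ^ 2 = 1 := by
  unfold pairSign; split_ifs <;> norm_num

lemma pairSign_swap {w a : Fin M} (h : a ≠ w) : pairSign a w = -pairSign w a := by
  unfold pairSign
  rcases lt_or_gt_of_ne h with h | h <;> simp [h, h.not_gt]

open Classical in
/-- The second-stage input: antipodal signalling between the two leading messages, and silence
when the transmitted message is not one of them. -/
noncomputable def antipodal (A : ℝ) (w : Fin M) (v : Fin M → ℝ) : ℝ :=
  if ∃ a, w < a ∧ Leads 0 v w a then A else if ∃ a, a < w ∧ Leads 0 v w a then -A else 0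

lemma antipodal_sq_le (A : ℝ) (w : Fin M) (v : Fin M → ℝ) : antipodal A w v ^ 2 ≤ A ^ 2 := by
  unfold antipodal
  split_ifs <;> simp [sq_nonneg]

lemma antipodal_eq (A : ℝ) {w a : Fin M} {v : Fin M → ℝ} (h : Leads 0 v w a) (haw : a ≠ w) :
    antipodal A w v = pairSign w a * A := by
  unfold antipodal pairSign
  rcases lt_or_gt_of_ne haw with hlt | hlt
  · have hno : ¬ ∃ b, w < b ∧ Leads 0 v w b := by
      rintro ⟨b, hb, hl⟩
      rw [← h.unique hl haw hb.ne'] at hb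
      exact hb.not_gt hlt
    rw [if_neg hno, if_pos ⟨a, hlt, h⟩, if_neg hlt.not_gt]
    ring
  · rw [if_pos ⟨a, hlt, h⟩, if_pos hlt]
    ring

lemma measurable_antipodal (A : ℝ) (w : Fin M) : Measurable (antipodal A w) := by
  unfold antipodal
  refine Measurable.ite ?_ measurable_const (Measurable.ite ?_ measurable_const measurable_const)
  · exact measurableSet_setOfPred.2 <| Measurable.exists fun a =>
      measurable_const.and (measurable_leads 0 w a)
  · exact measurableSet_setOfPred.2 <| Measurable.exists fun a =>
      measurable_const.and (measurable_leads 0 w a)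

/-- Message `w` is rejected given the first-stage outputs `y` and the second-stage output `t`:
either `w` neither is nearest nor belongs to a clearly leading pair, or the other member of the
clearly leading pair is at least as likely. -/
def Rejects (m A τ : ℝ) (w : Fin M) (p : (Fin M → ℝ) × ℝ) : Prop :=
  (∃ a c, a ≠ w ∧ c ≠ w ∧ c ≠ a ∧ p.1 w ≤ p.1 a ∧ p.1 w ≤ p.1 c + τ) ∨
    ∃ a, a ≠ w ∧ Leads τ p.1 w a ∧ pairSign w a * A * p.2 + m / 2 * (p.1 w - p.1 a) ≤ 0

lemma measurable_rejects (m A τ : ℝ) (w : Fin M) : Measurable (Rejects m A τ w) := by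
  unfold Rejects
  refine Measurable.or (Measurable.exists fun a => Measurable.exists fun c =>
    measurable_const.and <| measurable_const.and <| measurable_const.and <| Measurable.and ?_ ?_)
    (Measurable.exists fun a => measurable_const.and <|
      ((measurable_leads τ w a).comp measurable_fst).and ?_)
  · exact measurableSet_setOfPred.1 (measurableSet_le (by fun_prop) (by fun_prop))
  · exact measurableSet_setOfPred.1 (measurableSet_le (by fun_prop) (by fun_prop))
  · exact measurableSet_setOfPred.1 (measurableSet_le (by fun_prop) (by fun_prop))

/-- At most one message is not rejected. -/
lemma eq_of_not_rejects {m A τ : ℝ} {w a : Fin M} {p : (Fin M → ℝ) × ℝ}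
    (hw : ¬ Rejects m A τ w p) (ha : ¬ Rejects m A τ a p) : a = w := by
  wlog hle : p.1 w ≤ p.1 a generalizing w a
  · exact (this ha hw (not_le.1 hle).le).symm
  by_contra haw
  simp only [Rejects, not_or, not_exists, not_and, not_le] at hw ha
  have hL : Leads τ p.1 w a := by
    intro c hcw hca
    have := hw.1 a c haw hcw hca hle
    exact ⟨this, this.trans_le hle⟩
  have h1 := hw.2 a haw hL
  have h2 := ha.2 w (Ne.symm haw) hL.symm
  -- The test statistics of `w` and `a` are negatives of each other, so they cannot both be
  -- positive.
  rw [pairSign_swap haw] at h2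
  linarith

open Classical in
/-- The decoder selects the message that is not rejected, if there is one. -/
noncomputable def selectMessage (w₀ : Fin M) (b : Fin M → Prop) : Fin M :=
  if h : ∃ w, ¬ b w then h.choose else w₀

lemma selectMessage_eq (w₀ : Fin M) {m A τ : ℝ} {w : Fin M} {p : (Fin M → ℝ) × ℝ}
    (hw : ¬ Rejects m A τ w p) : selectMessage w₀ (fun a => Rejects m A τ a p) = w := by
  have h : ∃ w, ¬ Rejects m A τ w p := ⟨w, hw⟩
  unfold selectMessage
  rw [dif_pos h]
  exact eq_of_not_rejects hw h.choose_spec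

variable {n : ℕ}

/-- The first-stage outputs and the second-stage output. -/
def stages (hMn : M < n) (y : Fin n → ℝ) : (Fin M → ℝ) × ℝ :=
  (fun j => y (j.castLE hMn.le), y ⟨M, hMn⟩)

lemma measurable_stages (hMn : M < n) : Measurable (stages hMn) := by
  unfold stages
  fun_prop

/-- Simplex signalling in the first `M` channel uses, antipodal signalling between the two
messages that lead in the noisy feedback in the next use, and silence afterwards. -/
noncomputable def twoStageCode (hMn : M < n) (w₀ : Fin M) (m A τ : ℝ) : Code M n where
  enc w i past :=
    -- Centring by `1 / M` keeps codeword differences and saves energy `m ^ 2 / M`.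
    if i.val < M then m * ((if i.val = w.val then 1 else 0) - 1 / M)
    else if h : i.val = M then antipodal A w fun j => past ⟨j, by omega⟩
    else 0
  dec y := selectMessage w₀ fun a => Rejects m A τ a (stages hMn y)
  measurable_enc w i := by
    by_cases h1 : i.val < M
    · simp only [h1, if_true]; fun_prop
    · by_cases h2 : i.val = M
      · simp only [if_neg h1, dif_pos h2]
        exact (measurable_antipodal A w).comp
          (measurable_pi_lambda _ fun j => measurable_pi_apply _)
      · simp only [h1, h2, if_false, dif_neg, not_false_eq_true]; fun_prop
  measurable_dec :=
    -- The decoder factors through the finite type `Fin M → Prop`.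
    (measurable_of_countable (selectMessage w₀)).comp <| measurable_pi_lambda _ fun a =>
      (measurable_rejects m A τ a).comp (measurable_stages hMn)

variable (hMn : M < n) (w₀ : Fin M) (m A τ : ℝ)

lemma twoStageCode_input_first (w : Fin M) (ω : (Fin n → ℝ) × (Fin n → ℝ)) (j : Fin M) :
    (twoStageCode hMn w₀ m A τ).input w ω (j.castLE hMn.le)
      = m * ((if j = w then 1 else 0) - 1 / M) := by
  simp [Code.input, twoStageCode, Fin.ext_iff]

lemma twoStageCode_input_second (w : Fin M) (ω : (Fin n → ℝ) × (Fin n → ℝ)) :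
    (twoStageCode hMn w₀ m A τ).input w ω ⟨M, hMn⟩
      = antipodal A w fun j => (twoStageCode hMn w₀ m A τ).feedback w ω (j.castLE hMn.le) := by
  simp [Code.input, twoStageCode, Fin.castLE]

lemma twoStageCode_input_of_lt (w : Fin M) (ω : (Fin n → ℝ) × (Fin n → ℝ)) {i : Fin n}
    (hi : M < i.val) : (twoStageCode hMn w₀ m A τ).input w ω i = 0 := by
  simp [Code.input, twoStageCode, hi.not_gt, hi.ne']

lemma Code.feedback_eq (c : Code M n) (w : Fin M) (ω : (Fin n → ℝ) × (Fin n → ℝ)) (i : Fin n) :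
    c.feedback w ω i = c.output w ω i + ω.2 i := by
  rw [Code.feedback]; rfl

lemma sum_simplex_sq (hM : 0 < M) (w : Fin M) :
    ∑ j : Fin M, (m * ((if j = w then 1 else 0) - 1 / (M : ℝ))) ^ 2 = m ^ 2 * (1 - 1 / M) := by
  have hM' : (M : ℝ) ≠ 0 := by positivity
  have h : ∀ j : Fin M, (m * ((if j = w then 1 else 0) - 1 / (M : ℝ))) ^ 2
      = (if j = w then m ^ 2 * (1 - 2 / M) else 0) + m ^ 2 / M ^ 2 := by
    intro j
    split_ifs <;> field_simp <;> ring
  simp only [h, Finset.sum_add_distrib, Finset.sum_ite_eq', Finset.mem_univ, if_true,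
    Finset.sum_const, Finset.card_univ, Fintype.card_fin, nsmul_eq_mul]
  field_simp
  ring

lemma twoStageCode_energy (hM : 0 < M) (w : Fin M) (ω : (Fin n → ℝ) × (Fin n → ℝ)) :
    ∑ i : Fin n, (twoStageCode hMn w₀ m A τ).input w ω i ^ 2
      ≤ m ^ 2 * (1 - 1 / M) + A ^ 2 := by
  obtain ⟨k, rfl⟩ : ∃ k, n = (M + 1) + k := ⟨n - (M + 1), by omega⟩
  rw [Fin.sum_univ_add, Fin.sum_univ_castSucc]
  have h0 : ∑ i : Fin k, (twoStageCode hMn w₀ m A τ).input w ω (Fin.natAdd (M + 1) i) ^ 2 = 0 :=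
    Finset.sum_eq_zero fun i _ => by
      rw [twoStageCode_input_of_lt _ _ _ _ _ _ _ (by simp; omega)]; simp
  have h1 := sum_simplex_sq m hM w
  have h2 : ∀ j : Fin M, (twoStageCode hMn w₀ m A τ).input w ω (Fin.castAdd k j.castSucc)
      = m * ((if j = w then 1 else 0) - 1 / M) :=
    fun j => twoStageCode_input_first hMn w₀ m A τ w ω j
  have h3 := twoStageCode_input_second hMn w₀ m A τ w ω
  have h4 : Fin.castAdd k (Fin.last M) = ⟨M, hMn⟩ := rfl
  rw [h0, h4, h3]
  simp only [h2, h1, add_zero]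
  exact add_le_add_right (antipodal_sq_le _ _ _) _

/-- A decoding error forces a large deviation of one of three kinds. -/
lemma twoStageCode_error (w : Fin M) (ω : (Fin n → ℝ) × (Fin n → ℝ))
    (h : (twoStageCode hMn w₀ m A τ).dec ((twoStageCode hMn w₀ m A τ).output w ω) ≠ w) :
    ∃ a c : Fin M,
      τ < ω.2 (c.castLE hMn.le) - ω.2 (a.castLE hMn.le) ∨
      (a ≠ w ∧ c ≠ w ∧ c ≠ a ∧ m ≤ ω.1 (a.castLE hMn.le) - ω.1 (w.castLE hMn.le) ∧
        m - τ ≤ ω.1 (c.castLE hMn.le) - ω.1 (w.castLE hMn.le)) ∨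
      (a ≠ w ∧ A ^ 2 + m ^ 2 / 2 ≤ m / 2 * (ω.1 (a.castLE hMn.le) - ω.1 (w.castLE hMn.le))
        - pairSign w a * A * ω.1 ⟨M, hMn⟩) := by
  by_contra hcon
  push Not at hcon
  refine h (selectMessage_eq w₀ fun hrej => ?_)
  have hy : ∀ j : Fin M, (twoStageCode hMn w₀ m A τ).output w ω (j.castLE hMn.le)
      = m * ((if j = w then 1 else 0) - 1 / M) + ω.1 (j.castLE hMn.le) := fun j => by
    rw [Code.output, twoStageCode_input_first]
  have hyw := hy w
  rw [if_pos rfl] at hyw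
  rcases hrej with ⟨a, c, haw, hcw, hca, h1, h2⟩ | ⟨a, haw, hL, h1⟩
  · have hya := hy a
    have hyc := hy c
    rw [if_neg haw] at hya
    rw [if_neg hcw] at hyc
    simp only [stages, hya, hyc, hyw] at h1 h2
    have := (hcon a c).2.1 haw hcw hca (by linarith)
    linarith
  · have hya := hy a
    rw [if_neg haw] at hya
    have hL' := hL.perturb
      (v' := fun j => (twoStageCode hMn w₀ m A τ).feedback w ω (j.castLE hMn.le)) fun i c => by
        simpa [stages, Code.feedback_eq] using (hcon i c).1
    have hyM : (twoStageCode hMn w₀ m A τ).output w ω ⟨M, hMn⟩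
        = pairSign w a * A + ω.1 ⟨M, hMn⟩ := by
      rw [Code.output, twoStageCode_input_second, antipodal_eq A hL' haw]
    simp only [stages, hya, hyw, hyM] at h1
    have h2 := (hcon a a).2.2 haw
    have h3 : pairSign w a * A * (pairSign w a * A) = A ^ 2 := by
      linear_combination A ^ 2 * pairSign_sq w a
    linarith

end Scheme

/-! ### Error analysis -/

lemma quadratic_pos (s : ℝ) : 0 < s ^ 2 - 2 * s + 4 := by nlinarith [sq_nonneg (s - 1)]

lemma coe_alphaStar (s : ℝ) :
    (alphaStar s : ℝ) = 3 * s ^ 2 / (4 * (s ^ 2 - 2 * s + 4)) := rfl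

/-! ### The three error events, with equal exponents -/

section Tails

variable {n : ℕ} {s u m A : ℝ}

lemma backward_event_le (hs0 : 0 ≤ s) (hm0 : 0 ≤ m) (hm : m ^ 2 = 6 * u) (a c : Fin n) :
    noise (alphaStar s) n {ω | m * s / 2 < ω.2 c - ω.2 a}
      ≤ ENNReal.ofReal (Real.exp (-(u * (s ^ 2 - 2 * s + 4) / 2))) := by
  have hτ : 0 ≤ m * s / 2 := by positivity
  rcases eq_or_ne a c with rfl | hac
  · have : {ω : (Fin n → ℝ) × (Fin n → ℝ) | m * s / 2 < ω.2 a - ω.2 a} = ∅ := by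
      ext ω; simpa using hτ
    rw [this, measure_empty]
    exact zero_le
  -- At `s = 0` the Chernoff exponent is `0 / 0`, hence useless; there the feedback noise vanishes
  -- almost surely.
  rcases hs0.eq_or_lt with rfl | hs
  · have h0 : alphaStar 0 = 0 := NNReal.eq (by simp [coe_alphaStar])
    have : noise (alphaStar 0) n {ω | m * 0 / 2 < ω.2 c - ω.2 a} = 0 := by
      rw [h0]
      have h := (noise_zero_backward_eq_zero n).mono fun ω (h : ω.2 = 0) =>
        (by simp [h] : ¬ m * 0 / 2 < ω.2 c - ω.2 a)
      simpa only [ae_iff, not_not] using h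
    rw [this]
    exact zero_le
  · have h := noise_backward_tail (alphaStar s) ![c, a]
      (by intro i j; fin_cases i <;> fin_cases j <;> simp [hac, hac.symm]) ![1, -1] hτ
    refine (measure_mono fun ω hω => ?_).trans (h.trans_eq ?_)
    · simp only [Set.mem_ofPred_eq, Fin.sum_univ_two] at hω ⊢
      simp
      linarith
    · congr 2
      have hq := (quadratic_pos s).ne'
      simp only [Fin.sum_univ_two, coe_alphaStar]
      simp
      field_simp
      rw [hm]
      ring

/-- The two inequalities are combined with weights `2 + s` and `2 - 2 * s`, proportional to the
Lagrange multipliers of the least-norm noise meeting both; `s ≤ 1` keeps them nonnegative. -/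
lemma forward_event_le (α : ℝ≥0) (hs0 : 0 ≤ s) (hs1 : s ≤ 1) (hm0 : 0 ≤ m) (hm : m ^ 2 = 6 * u) {w a c : Fin n}
    (haw : a ≠ w) (hcw : c ≠ w) (hca : c ≠ a) :
    noise α n {ω | m ≤ ω.1 a - ω.1 w ∧ m - m * s / 2 ≤ ω.1 c - ω.1 w}
      ≤ ENNReal.ofReal (Real.exp (-(u * (s ^ 2 - 2 * s + 4) / 2))) := by
  have hq := quadratic_pos s
  have h := noise_forward_tail α ![w, a, c]
      (by intro i j; fin_cases i <;> fin_cases j <;>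
        simp [haw, hcw, hca, haw.symm, hcw.symm, hca.symm])
      ![-(4 - s), 2 + s, 2 - 2 * s] (x := m * (s ^ 2 - 2 * s + 4)) (by positivity)
  refine (measure_mono fun ω hω => ?_).trans (h.trans_eq ?_)
  · obtain ⟨h1, h2⟩ := hω
    have h3 := mul_le_mul_of_nonneg_left h1 (by linarith : 0 ≤ 2 + s)
    have h4 := mul_le_mul_of_nonneg_left h2 (by linarith : 0 ≤ 2 - 2 * s)
    simp only [Set.mem_ofPred_eq, Fin.sum_univ_three]
    simp
    linarith
  · congr 2
    have hv : ∑ j, (![-(4 - s), 2 + s, 2 - 2 * s] : Fin 3 → ℝ) j ^ 2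
        = 6 * (s ^ 2 - 2 * s + 4) := by
      simp [Fin.sum_univ_three]; ring
    rw [hv, mul_pow, hm]
    field_simp

/-- Half the log-likelihood ratio has mean and variance both `A ^ 2 + m ^ 2 / 2`, so the exponent is
half that number. -/
lemma pair_event_le (α : ℝ≥0) (hm : m ^ 2 = 6 * u) (hA : A ^ 2 = (1 - s) ^ 2 * u) {σ : ℝ} (hσ : σ ^ 2 = 1) {w a k : Fin n}
    (haw : a ≠ w) (hkw : k ≠ w) (hka : k ≠ a) :
    noise α n {ω | A ^ 2 + m ^ 2 / 2
        ≤ m / 2 * (ω.1 a - ω.1 w) - σ * A * ω.1 k}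
      ≤ ENNReal.ofReal (Real.exp (-(u * (s ^ 2 - 2 * s + 4) / 2))) := by
  have h := noise_forward_tail α ![w, a, k]
      (by intro i j; fin_cases i <;> fin_cases j <;>
        simp [haw, hkw, hka, haw.symm, hkw.symm, hka.symm])
      ![-(m / 2), m / 2, -(σ * A)]
      (x := A ^ 2 + m ^ 2 / 2) (by positivity)
  refine (measure_mono fun ω hω => ?_).trans (h.trans_eq ?_)
  · simp only [Set.mem_ofPred_eq, Fin.sum_univ_three] at hω ⊢
    simp
    linarith
  · congr 2
    have hx : A ^ 2 + m ^ 2 / 2 = u * (s ^ 2 - 2 * s + 4) := by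
      rw [hA, hm]; ring
    have hv : ∑ j, (![-(m / 2), m / 2, -(σ * A)] : Fin 3 → ℝ) j ^ 2
        = u * (s ^ 2 - 2 * s + 4) := by
      rw [← hx]
      simp [Fin.sum_univ_three]
      linear_combination A ^ 2 * hσ
    rw [hv, hx]
    rcases eq_or_ne (u * (s ^ 2 - 2 * s + 4)) 0 with h0 | h0
    · simp [h0]
    · field_simp

end Tails

lemma twoStageCode_errorProb_le {M n : ℕ} (hMn : M < n) (w₀ : Fin M) {s u : ℝ} (hs0 : 0 ≤ s)
    (hs1 : s ≤ 1) (hu : 0 ≤ u) :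
    (twoStageCode hMn w₀ √(6 * u) ((1 - s) * √u) (√(6 * u) * s / 2)).errorProb (alphaStar s)
      ≤ 3 * M ^ 2 * ENNReal.ofReal (Real.exp (-(u * (s ^ 2 - 2 * s + 4) / 2))) := by
  set ε := ENNReal.ofReal (Real.exp (-(u * (s ^ 2 - 2 * s + 4) / 2)))
  set C := twoStageCode hMn w₀ √(6 * u) ((1 - s) * √u) (√(6 * u) * s / 2)
  set μ := noise (alphaStar s) n
  have hm : √(6 * u) ^ 2 = 6 * u := Real.sq_sqrt (by positivity)
  have hA : ((1 - s) * √u) ^ 2 = (1 - s) ^ 2 * u := by rw [mul_pow, Real.sq_sqrt hu]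
  have hinj : ∀ {i j : Fin M}, i ≠ j → i.castLE hMn.le ≠ j.castLE hMn.le :=
    fun h h' => h (Fin.castLE_injective _ h')
  have hlast : ∀ i : Fin M, (⟨M, hMn⟩ : Fin n) ≠ i.castLE hMn.le := by
    intro i h
    have := congrArg Fin.val h
    simp at this
    omega
  have hw : ∀ w : Fin M, μ {ω | C.dec (C.output w ω) ≠ w} ≤ 3 * M ^ 2 * ε := by
    intro w
    let E₁ (p : Fin M × Fin M) : Set ((Fin n → ℝ) × (Fin n → ℝ)) :=
      {ω | √(6 * u) * s / 2 < ω.2 (p.2.castLE hMn.le) - ω.2 (p.1.castLE hMn.le)}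
    let E₂ (p : Fin M × Fin M) : Set ((Fin n → ℝ) × (Fin n → ℝ)) :=
      {ω | p.1 ≠ w ∧ p.2 ≠ w ∧ p.2 ≠ p.1 ∧
        √(6 * u) ≤ ω.1 (p.1.castLE hMn.le) - ω.1 (w.castLE hMn.le) ∧
        √(6 * u) - √(6 * u) * s / 2 ≤ ω.1 (p.2.castLE hMn.le) - ω.1 (w.castLE hMn.le)}
    let E₃ (p : Fin M × Fin M) : Set ((Fin n → ℝ) × (Fin n → ℝ)) :=
      {ω | p.1 ≠ w ∧ ((1 - s) * √u) ^ 2 + √(6 * u) ^ 2 / 2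
        ≤ √(6 * u) / 2 * (ω.1 (p.1.castLE hMn.le) - ω.1 (w.castLE hMn.le))
          - pairSign w p.1 * ((1 - s) * √u) * ω.1 ⟨M, hMn⟩}
    have hE₁ : ∀ p, μ (E₁ p) ≤ ε := fun p => backward_event_le hs0 (Real.sqrt_nonneg _) hm _ _
    have hE₂ : ∀ p, μ (E₂ p) ≤ ε := by
      intro p
      by_cases hp : p.1 ≠ w ∧ p.2 ≠ w ∧ p.2 ≠ p.1
      · exact (measure_mono fun ω hω => hω.2.2.2).trans
          (forward_event_le (alphaStar s) hs0 hs1 (Real.sqrt_nonneg _) hm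
            (hinj hp.1) (hinj hp.2.1) (hinj hp.2.2))
      · have : E₂ p = ∅ := Set.eq_empty_of_forall_notMem fun ω hω =>
          hp ⟨hω.1, hω.2.1, hω.2.2.1⟩
        simp [this]
    have hE₃ : ∀ p, μ (E₃ p) ≤ ε := by
      intro p
      by_cases hp : p.1 ≠ w
      · exact (measure_mono fun ω hω => hω.2).trans
          (pair_event_le (alphaStar s) hm hA (pairSign_sq w p.1) (hinj hp) (hlast _) (hlast _))
      · have : E₃ p = ∅ := Set.eq_empty_of_forall_notMem fun ω hω => hp hω.1
        simp [this]
    calc μ {ω | C.dec (C.output w ω) ≠ w}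
        ≤ μ (⋃ p, E₁ p ∪ (E₂ p ∪ E₃ p)) := measure_mono fun ω hω => by
          obtain ⟨a, c, h⟩ := twoStageCode_error hMn w₀ _ _ _ w ω hω
          exact Set.mem_iUnion.2 ⟨(a, c), h⟩
      _ ≤ ∑ p, μ (E₁ p ∪ (E₂ p ∪ E₃ p)) := measure_iUnion_fintype_le _ _
      _ ≤ ∑ _p : Fin M × Fin M, (ε + (ε + ε)) := Finset.sum_le_sum fun p _ =>
          (measure_union_le _ _).trans (add_le_add (hE₁ p)
            ((measure_union_le _ _).trans (add_le_add (hE₂ p) (hE₃ p))))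
      -- Three events for each of the `M ^ 2` pairs `(a, c)`.
      _ = 3 * M ^ 2 * ε := by simp; ring
  unfold Code.errorProb
  refine ENNReal.div_le_of_le_mul ?_
  calc ∑ w, μ {ω | C.dec (C.output w ω) ≠ w} ≤ ∑ _w : Fin M, 3 * M ^ 2 * ε :=
        Finset.sum_le_sum fun w _ => hw w
    _ = 3 * M ^ 2 * ε * M := by simp; ring

/-- A nonasymptotic bound for the two-stage scheme using total energy `n P`. -/
lemma bestErrorProb_le {M n : ℕ} (hM : 2 ≤ M) (hMn : M < n) {P s : ℝ} (hP : 0 ≤ P) (hs0 : 0 ≤ s)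
    (hs1 : s ≤ 1) :
    bestErrorProb M n P (alphaStar s) ≤ ENNReal.ofReal (3 * M ^ 2 * Real.exp (-(n * (P / 2 *
      (1 - 3 * ((M : ℝ) - 2) /
        ((M : ℝ) * (s ^ 2 - 2 * s + 4) + 3 * ((M : ℝ) - 2))))))) := by
  have hM2 : (2 : ℝ) ≤ M := by exact_mod_cast hM
  have hq := quadratic_pos s
  set D := (M : ℝ) * (s ^ 2 - 2 * s + 4) + 3 * ((M : ℝ) - 2) with hD
  have hDpos : 0 < D := by
    have : 0 < (M : ℝ) * (s ^ 2 - 2 * s + 4) := by positivity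
    linarith
  have hu : 0 ≤ n * P * M / D := by positivity
  -- The energy bound for parameter `u` is `u * D / M`, so `u = n * P * M / D` makes it exactly `n *
  -- P`.
  have hpe : (twoStageCode hMn ⟨0, by omega⟩ √(6 * (n * P * M / D)) ((1 - s) * √(n * P * M / D))
      (√(6 * (n * P * M / D)) * s / 2)).PeakEnergy (alphaStar s) P := by
    refine fun w => ae_of_all _ fun ω =>
      (twoStageCode_energy hMn _ _ _ _ (by omega) w ω).trans_eq ?_
    rw [mul_pow, Real.sq_sqrt hu, Real.sq_sqrt (by positivity)]
    field_simp
    rw [hD]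
    ring
  refine (iInf₂_le (f := fun (c : Code M n) (_ : c.PeakEnergy (alphaStar s) P) =>
    c.errorProb (alphaStar s)) _ hpe).trans ((twoStageCode_errorProb_le hMn _ hs0 hs1 hu).trans_eq ?_)
  rw [ENNReal.ofReal_mul (by positivity)]
  congr 1
  · rw [ENNReal.ofReal_mul (by norm_num), ENNReal.ofReal_pow (by positivity)]; simp
  · congr 3
    field_simp
    rw [hD]
    ring

end NoisyFeedback

open NoisyFeedback

theorem theorem1 (M : ℕ) (hM : 2 ≤ M) (P : ℝ) (hP : 0 ≤ P) (s : ℝ) (hs0 : 0 ≤ s) (hs1 : s ≤ 1) :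
    ((P / 2 * (1 - 3 * ((M : ℝ) - 2) /
        ((M : ℝ) * (s ^ 2 - 2 * s + 4) + 3 * ((M : ℝ) - 2))) : ℝ) : EReal)
      ≤ NoisyFeedback.errorExponent M P (NoisyFeedback.alphaStar s) := by
  set E := P / 2 * (1 - 3 * ((M : ℝ) - 2) /
    ((M : ℝ) * (s ^ 2 - 2 * s + 4) + 3 * ((M : ℝ) - 2))) with hE
  have hMpos : (0 : ℝ) < M := by exact_mod_cast (by omega : 0 < M)
  have hlim : Tendsto (fun n : ℕ => ((E - Real.log (3 * M ^ 2) / n : ℝ) : EReal)) atTop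
      (𝓝 (E : EReal)) := by
    refine (continuous_coe_real_ereal.tendsto E).comp ?_
    simpa using tendsto_const_nhds.sub
      (tendsto_natCast_atTop_atTop.const_div_atTop (Real.log (3 * M ^ 2)))
  -- The prefactor `3 * M ^ 2` costs only `Real.log (3 * M ^ 2) / n`, which vanishes in the limit.
  rw [← hlim.limsup_eq, NoisyFeedback.errorExponent]
  refine limsup_le_limsup ?_
  filter_upwards [eventually_gt_atTop M] with n hn
  have hnpos : (0 : ℝ) < n := by exact_mod_cast (by omega : 0 < n)
  have hlog := ENNReal.log_le_log (bestErrorProb_le hM hn hP hs0 hs1)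
  rw [ENNReal.log_ofReal_of_pos (by positivity), Real.log_mul (by positivity) (by positivity),
    Real.log_exp, ← hE] at hlog
  have hval : ((E - Real.log (3 * M ^ 2) / n : ℝ) : EReal)
      = -((Real.log (3 * M ^ 2) + -(n * E) : ℝ) : EReal) / (n : EReal) := by
    have : (n : EReal) = ((n : ℝ) : EReal) := rfl
    rw [this, ← EReal.coe_neg, ← EReal.coe_div]
    congr 1
    field_simp
    ring
  rw [hval]
  exact EReal.div_le_div_right_of_nonneg (by positivity) (EReal.neg_le_neg_iff.2 hlog)
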